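/- Write permutations in one-line notation. For $q\in S_k$ and $p=p_1p_2\cdots p_n\in S_n$, let $f_q(p)$ be the number of occurrences of $q$ in $p$ as a pattern, that is, the number of index sequences $1\le i_1<i_2<\cdots<i_k\le n$ such that, for all $a,b\in\{1,\dots,k\}$, $q_a<q_b$ if and only if $p_{i_a}<p_{i_b}$. Let $\mathrm{Av}_n(123)$ be the set of all $p\in S_n$ with no occurrence of the pattern $123$, and put $f_q(\mathrm{Av}_n(123))=\sum_{p\in \mathrm{Av}_n(123)} f_q(p)$. Proposition. Let $k$ be a positive integer, and let $q$ be any permutation in $S_k$ other than the decreasing permutation $k\cdots 321$. Then there is an $N$ such that for all $n\ge N$ $$f_{k\cdots 321}(\mathrm{Av}_n(123)) > f_q(\mathrm{Av}_n(123)).$$ -/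

import Mathlib

/-- `f` selects the positions of an occurrence of the pattern `q` in the permutation `p`:
the positions are increasing, and the entries of `p` there are in the same relative order
as the entries of `q`. -/
def IsOccurrence {k n : ℕ} (q : Equiv.Perm (Fin k)) (p : Equiv.Perm (Fin n))
    (f : Fin k → Fin n) : Prop :=
  (∀ a b, a < b → f a < f b) ∧ ∀ a b, q a < q b ↔ p (f a) < p (f b)

instance {k n : ℕ} (q : Equiv.Perm (Fin k)) (p : Equiv.Perm (Fin n)) :
    DecidablePred (IsOccurrence q p) :=
  fun f => inferInstanceAs (Decidable
    ((∀ a b, a < b → f a < f b) ∧ ∀ a b, q a < q b ↔ p (f a) < p (f b)))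

/-- The number of occurrences of `q` in `p` as a pattern. -/
def patternCount {k n : ℕ} (q : Equiv.Perm (Fin k)) (p : Equiv.Perm (Fin n)) : ℕ :=
  (Finset.univ.filter (IsOccurrence q p)).card

/-- `p` contains `q` as a pattern. -/
def ContainsPattern {k n : ℕ} (q : Equiv.Perm (Fin k)) (p : Equiv.Perm (Fin n)) : Prop :=
  ∃ f : Fin k → Fin n, IsOccurrence q p f

instance {k n : ℕ} (q : Equiv.Perm (Fin k)) (p : Equiv.Perm (Fin n)) :
    Decidable (ContainsPattern q p) :=
  inferInstanceAs (Decidable (∃ f : Fin k → Fin n, IsOccurrence q p f))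

/-- The permutations of length `n` that avoid the pattern `r`. -/
def avoiders {m : ℕ} (n : ℕ) (r : Equiv.Perm (Fin m)) : Finset (Equiv.Perm (Fin n)) :=
  Finset.univ.filter (fun p => ¬ ContainsPattern r p)

/-- The total number of occurrences of `q` in the permutations of the finite set `C`. -/
def totalCount {k n : ℕ} (q : Equiv.Perm (Fin k)) (C : Finset (Equiv.Perm (Fin n))) : ℕ :=
  ∑ p ∈ C, patternCount q p

/-- The increasing pattern `123`. -/
def pattern123 : Equiv.Perm (Fin 3) := 1

/-- The decreasing permutation `k ⋯ 21`, sending `i` to `k - 1 - i` (indices from `0`). -/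
def decreasingPerm (k : ℕ) : Equiv.Perm (Fin k) := Fin.revPerm

/-!
The `123`-avoiding permutations form a generating tree, in which the children of `p` arise by
inserting a new largest entry weakly inside the initial decreasing run of `p`; a node whose run has
length `s` has children with runs of lengths `1, …, s + 1`. Along an edge, the number of
noninversions grows by at most the run length `s` of the child, hence, by the Cauchy–Schwarz
inequality `(x + s)² / (n + 2) ≤ x² / (n + 1) + s²`, its normalized square grows by at most `s²`.
The tree is counted by ballot numbers, and a quadratic bound for the mean sum of the `s²` along a
path to depth `n` propagates down the tree. So the mean number of noninversions is `O(n ^ (3 / 2))`,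
which is `o(n ^ 2)`.

An increasing selection of `k` positions whose entries are not decreasing contains a noninversion,
so these selections are a vanishing proportion of all selections of `k` positions. Every occurrence
of a pattern other than `k ⋯ 21` is among them, and the others are the occurrences of `k ⋯ 21`.
-/

/-- The ballot number `(s + 1) (2 r + s)! / (r! (r + s + 1)!)`. In the generating tree in which a
node labelled `s` has children labelled `1, …, s + 1`, it is the number of descendants `r` levels
below a node labelled `s`. -/
def ballot (r s : ℕ) : ℚ :=
  (s + 1) * (2 * r + s).factorial / (r.factorial * (r + s + 1).factorial)

theorem ballot_nonneg (r s : ℕ) : 0 ≤ ballot r s := by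
  unfold ballot
  positivity

theorem ballot_zero_left (s : ℕ) : ballot 0 s = 1 := by
  simp only [ballot, mul_zero, zero_add, Nat.factorial_zero, Nat.factorial_succ]
  push_cast
  field_simp

theorem ballot_succ_zero (r : ℕ) : ballot (r + 1) 0 = ballot r 1 := by
  rw [ballot, ballot, show 2 * (r + 1) + 0 = 2 * r + 1 + 1 by ring,
    show r + 1 + 0 + 1 = r + 2 by ring, Nat.factorial_succ (2 * r + 1), Nat.factorial_succ r]
  push_cast
  field_simp
  ring

theorem exists_common_factor_ballot (r s : ℕ) : ∃ c : ℚ, 0 ≤ c ∧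
    ballot (r + 1) (s + 1) = c * ((s + 2) * (2 * r + s + 3)) ∧
    ballot (r + 1) s = c * ((s + 1) * (r + s + 3)) ∧
    ballot r (s + 2) = c * ((s + 3) * (r + 1)) := by
  refine ⟨(2 * r + s + 2).factorial / ((r + 1).factorial * (r + s + 3).factorial),
    by positivity, ?_, ?_, ?_⟩
  · rw [ballot, show 2 * (r + 1) + (s + 1) = 2 * r + s + 2 + 1 by ring,
      show r + 1 + (s + 1) + 1 = r + s + 3 by ring, Nat.factorial_succ (2 * r + s + 2)]
    push_cast
    ring
  · rw [ballot, show 2 * (r + 1) + s = 2 * r + s + 2 by ring,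
      show r + 1 + s + 1 = r + s + 2 by ring, Nat.factorial_succ (r + s + 2)]
    push_cast
    field_simp
    ring
  · rw [ballot, show 2 * r + (s + 2) = 2 * r + s + 2 by ring,
      show r + (s + 2) + 1 = r + s + 3 by ring, Nat.factorial_succ r]
    push_cast
    field_simp
    ring

theorem sum_Icc_ballot (r s : ℕ) : ∑ t ∈ Finset.Icc 1 (s + 1), ballot r t = ballot (r + 1) s := by
  induction s with
  | zero => simp [ballot_succ_zero]
  | succ s ih =>
    obtain ⟨c, -, h₁, h₂, h₃⟩ := exists_common_factor_ballot r s
    rw [Finset.sum_Icc_succ_top (by omega), ih, h₁, h₂, h₃]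
    ring

/-- An upper bound for the sum of the squares of the labels on the way from a node labelled `s`
to a descendant `r` levels below it, averaged over these descendants. It is quadratic in `r` and
`s` jointly, which is the true order of magnitude; its coefficients are chosen so that
`sum_Icc_ballot_mul_le` holds. -/
def labelSqBound (r s : ℕ) : ℚ := r * (3 * r + s ^ 2 + 2 * s)

theorem labelSqBound_zero_left (s : ℕ) : labelSqBound 0 s = 0 := by
  simp [labelSqBound]

theorem sum_Icc_ballot_mul_le (r s : ℕ) :
    ∑ t ∈ Finset.Icc 1 (s + 1), ballot r t * ((t : ℚ) ^ 2 + labelSqBound r t) ≤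
      ballot (r + 1) s * labelSqBound (r + 1) s := by
  induction s with
  | zero =>
    simp only [zero_add, Finset.Icc_self, Finset.sum_singleton, ballot_succ_zero]
    refine mul_le_mul_of_nonneg_left ?_ (ballot_nonneg r 1)
    simp only [labelSqBound]
    push_cast
    linarith
  | succ s ih =>
    obtain ⟨c, hc, h₁, h₂, h₃⟩ := exists_common_factor_ballot r s
    have slack_nonneg : 0 ≤ c * ((r + 1) * ((s + 3) * (2 * s ^ 2 + 5 * s + 5) + 6 * r)) := by
      positivity
    calc
      _ ≤ ballot (r + 1) s * labelSqBound (r + 1) s +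
          ballot r (s + 2) * ((s + 2 : ℕ) ^ 2 + labelSqBound r (s + 2)) := by
        rw [Finset.sum_Icc_succ_top (by omega)]
        gcongr
      _ = ballot (r + 1) (s + 1) * labelSqBound (r + 1) (s + 1) -
          c * ((r + 1) * ((s + 3) * (2 * s ^ 2 + 5 * s + 5) + 6 * r)) := by
        rw [h₁, h₂, h₃]
        simp only [labelSqBound]
        push_cast
        ring
      _ ≤ _ := sub_le_self _ slack_nonneg

section InsertMax

variable {n : ℕ}

/-- The permutation obtained from `p` by inserting a new largest entry at position `i`. -/
def insertMax (p : Equiv.Perm (Fin n)) (i : Fin (n + 1)) : Equiv.Perm (Fin (n + 1)) :=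
  ((finSuccEquiv' i).trans (Equiv.optionCongr p)).trans (finSuccEquiv' (Fin.last n)).symm

theorem insertMax_apply_self (p : Equiv.Perm (Fin n)) (i : Fin (n + 1)) :
    insertMax p i i = Fin.last n := by
  simp [insertMax]

theorem insertMax_apply_succAbove (p : Equiv.Perm (Fin n)) (i : Fin (n + 1)) (j : Fin n) :
    insertMax p i (i.succAbove j) = (p j).castSucc := by
  simp [insertMax]

theorem not_insertMax_apply_self_lt (p : Equiv.Perm (Fin n)) (i j : Fin (n + 1)) :
    ¬ insertMax p i i < insertMax p i j := by
  rw [insertMax_apply_self]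
  exact (Fin.le_last _).not_gt

theorem insertMax_apply_succAbove_lt_self (p : Equiv.Perm (Fin n)) (i : Fin (n + 1)) (j : Fin n) :
    insertMax p i (i.succAbove j) < insertMax p i i := by
  rw [insertMax_apply_self, insertMax_apply_succAbove]
  exact Fin.castSucc_lt_last _

theorem insertMax_apply_succAbove_lt_succAbove (p : Equiv.Perm (Fin n)) (i : Fin (n + 1))
    {a b : Fin n} :
    insertMax p i (i.succAbove a) < insertMax p i (i.succAbove b) ↔ p a < p b := by
  rw [insertMax_apply_succAbove, insertMax_apply_succAbove, Fin.castSucc_lt_castSucc_iff]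

theorem insertMax_bijective (n : ℕ) :
    Function.Bijective fun x : Equiv.Perm (Fin n) × Fin (n + 1) => insertMax x.1 x.2 := by
  refine (Fintype.bijective_iff_injective_and_card _).2 ⟨?_, ?_⟩
  · rintro ⟨p, i⟩ ⟨p', i'⟩ (h : insertMax p i = insertMax p' i')
    obtain rfl : i = i' := (insertMax p' i').injective <| by
      rw [← h, insertMax_apply_self, h, insertMax_apply_self]
    obtain rfl : p = p' := Equiv.ext fun j => Fin.castSucc_injective n <| by
      rw [← insertMax_apply_succAbove p i, h, insertMax_apply_succAbove]
    rfl
  · simp [Fintype.card_perm, Nat.factorial_succ, mul_comm]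

end InsertMax

section InitialRun

variable {n : ℕ} {α : Type*} [Preorder α]

open Classical in
/-- The length of the longest strictly decreasing prefix of the sequence `p`. On the
`123`-avoiding permutations it is the label of the generating tree. -/
noncomputable def initialRun (p : Fin n → α) : ℕ :=
  Nat.findGreatest (fun i => StrictAntiOn p {a | (a : ℕ) < i}) n

theorem initialRun_le (p : Fin n → α) : initialRun p ≤ n := by
  classical exact Nat.findGreatest_le n

theorem le_initialRun_iff (p : Fin n → α) {i : ℕ} (hi : i ≤ n) :
    i ≤ initialRun p ↔ StrictAntiOn p {a | (a : ℕ) < i} := by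
  classical
  refine ⟨fun h => ?_, fun h => Nat.le_findGreatest hi h⟩
  have run_decreasing : StrictAntiOn p {a | (a : ℕ) < initialRun p} :=
    Nat.findGreatest_spec (P := fun i => StrictAntiOn p {a | (a : ℕ) < i}) (Nat.zero_le n)
      fun a ha => absurd ha (Nat.not_lt_zero _)
  exact run_decreasing.mono fun a ha => lt_of_lt_of_le ha h

theorem initialRun_eq_of_not_strictAntiOn {p : Fin n → α} {i : ℕ} (hi : i ≤ n)
    (h : StrictAntiOn p {a | (a : ℕ) < i})
    (h' : i < n → ¬ StrictAntiOn p {a | (a : ℕ) < i + 1}) : initialRun p = i := by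
  refine le_antisymm ?_ ((le_initialRun_iff p hi).2 h)
  by_contra! hlt
  have hn : i < n := hlt.trans_le (initialRun_le p)
  exact h' hn ((le_initialRun_iff p hn).1 hlt)

end InitialRun

section GeneratingTree

variable {n : ℕ}

theorem strictAntiOn_insertMax_zero_iff (p : Equiv.Perm (Fin n)) (j : ℕ) :
    StrictAntiOn (insertMax p 0) {a | (a : ℕ) < j + 1} ↔ StrictAntiOn p {a | (a : ℕ) < j} := by
  constructor
  · intro h a ha b hb hab
    exact (insertMax_apply_succAbove_lt_succAbove p 0).1 <|
      h (by simpa using ha) (by simpa using hb) (Fin.succAbove_lt_succAbove_iff.2 hab)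
  · intro h a ha b hb hab
    obtain rfl | ⟨b, rfl⟩ := Fin.eq_self_or_eq_succAbove 0 b
    · exact absurd hab (Fin.not_lt_zero a)
    obtain rfl | ⟨a, rfl⟩ := Fin.eq_self_or_eq_succAbove 0 a
    · exact insertMax_apply_succAbove_lt_self p 0 b
    · exact (insertMax_apply_succAbove_lt_succAbove p 0).2 <|
        h (by simpa using ha) (by simpa using hb) (Fin.succAbove_lt_succAbove_iff.1 hab)

theorem initialRun_insertMax_zero (p : Equiv.Perm (Fin n)) :
    initialRun (insertMax p 0) = initialRun p + 1 := by
  have hle := initialRun_le p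
  refine initialRun_eq_of_not_strictAntiOn (by omega) ?_ fun hlt => ?_
  · rw [strictAntiOn_insertMax_zero_iff]
    exact (le_initialRun_iff p hle).1 le_rfl
  · rw [strictAntiOn_insertMax_zero_iff, ← le_initialRun_iff p (by omega)]
    omega

theorem initialRun_insertMax_of_ne_zero (p : Equiv.Perm (Fin n)) {i : Fin (n + 1)}
    (hi : i ≠ 0) (hle : (i : ℕ) ≤ initialRun p) : initialRun (insertMax p i) = i := by
  have hp := (le_initialRun_iff p (Nat.lt_succ_iff.1 i.2)).1 hle
  refine initialRun_eq_of_not_strictAntiOn i.2.le ?_ fun _ h => ?_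
  · intro a (ha : a < i) b (hb : b < i) hab
    obtain ⟨a, rfl⟩ := Fin.exists_succAbove_eq ha.ne
    obtain ⟨b, rfl⟩ := Fin.exists_succAbove_eq hb.ne
    rw [Fin.succAbove_lt_iff_castSucc_lt] at ha hb
    exact (insertMax_apply_succAbove_lt_succAbove p i).2 <|
      hp ha hb (Fin.succAbove_lt_succAbove_iff.1 hab)
  · exact not_insertMax_apply_self_lt p i 0 <|
      h (Nat.succ_pos i) (Nat.lt_succ_self i) (Fin.pos_iff_ne_zero.2 hi)

/-- The active sites of `p`: the positions weakly inside the initial decreasing run, where a new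
largest entry may be inserted into a `123`-avoiding permutation without creating a `123`. -/
noncomputable def activeSites (p : Equiv.Perm (Fin n)) : Finset (Fin (n + 1)) :=
  {i | (i : ℕ) ≤ initialRun p}

theorem mem_activeSites {p : Equiv.Perm (Fin n)} {i : Fin (n + 1)} :
    i ∈ activeSites p ↔ (i : ℕ) ≤ initialRun p := by
  simp [activeSites]

theorem mem_activeSites_iff_strictAntiOn {p : Equiv.Perm (Fin n)} {i : Fin (n + 1)} :
    i ∈ activeSites p ↔ StrictAntiOn p {a | a.castSucc < i} :=
  mem_activeSites.trans (le_initialRun_iff p (Nat.lt_succ_iff.1 i.2))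

theorem initialRun_insertMax {p : Equiv.Perm (Fin n)} {i : Fin (n + 1)} (hi : i ∈ activeSites p) :
    initialRun (insertMax p i) = if (i : ℕ) = 0 then initialRun p + 1 else i := by
  split_ifs with h
  · obtain rfl : i = 0 := Fin.ext h
    exact initialRun_insertMax_zero p
  · exact initialRun_insertMax_of_ne_zero p (fun h₀ => h (congrArg Fin.val h₀))
      (mem_activeSites.1 hi)

theorem sum_activeSites {M : Type*} [AddCommMonoid M] (p : Equiv.Perm (Fin n)) (u : ℕ → M) :
    ∑ i ∈ activeSites p, u (initialRun (insertMax p i)) =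
      ∑ t ∈ Finset.Icc 1 (initialRun p + 1), u t := by
  refine Finset.sum_nbij (fun i => initialRun (insertMax p i)) ?_ ?_ ?_ fun _ _ => rfl
  · intro i hi
    have := mem_activeSites.1 hi
    rw [Finset.mem_Icc, initialRun_insertMax hi]
    split_ifs <;> omega
  · intro i hi j hj (hij : initialRun (insertMax p i) = initialRun (insertMax p j))
    have := mem_activeSites.1 hi
    have := mem_activeSites.1 hj
    rw [initialRun_insertMax hi, initialRun_insertMax hj] at hij
    apply Fin.ext
    split_ifs at hij <;> omega
  · intro t ht
    have hrun := initialRun_le p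
    rw [Finset.mem_coe, Finset.mem_Icc] at ht
    obtain rfl | hlt := ht.2.eq_or_lt
    · exact ⟨0, mem_activeSites.2 (Nat.zero_le _), initialRun_insertMax_zero p⟩
    · have hmem : (⟨t, by omega⟩ : Fin (n + 1)) ∈ activeSites p :=
        mem_activeSites.2 (Nat.lt_succ_iff.1 hlt)
      exact ⟨_, hmem, (initialRun_insertMax hmem).trans (if_neg (by grind))⟩

theorem mem_avoiders_pattern123 {p : Equiv.Perm (Fin n)} :
    p ∈ avoiders n pattern123 ↔ ∀ a b c, a < b → b < c → p a < p b → ¬ p b < p c := by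
  simp only [avoiders, Finset.mem_filter, Finset.mem_univ, true_and, ContainsPattern, not_exists]
  constructor
  · intro h a b c hab hbc hpab hpbc
    have positions_mono : StrictMono ![a, b, c] := by simp [strictMono_vecCons, hab, hbc]
    have entries_mono : StrictMono (p ∘ ![a, b, c]) := by
      simp [Fin.strictMono_iff_lt_succ, Fin.forall_fin_two, hpab, hpbc]
    exact h ![a, b, c] ⟨fun x y hxy => positions_mono hxy, fun x y => entries_mono.lt_iff_lt.symm⟩
  · rintro h f ⟨hf, hp⟩
    exact h (f 0) (f 1) (f 2) (hf _ _ (by decide)) (hf _ _ (by decide))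
      ((hp 0 1).1 (by decide)) ((hp 1 2).1 (by decide))

theorem decreasingPerm_mem_avoiders (n : ℕ) : decreasingPerm n ∈ avoiders n pattern123 :=
  mem_avoiders_pattern123.2 fun _ _ _ hab _ h => absurd (Fin.rev_lt_rev.1 h) hab.not_gt

theorem insertMax_mem_avoiders_iff {p : Equiv.Perm (Fin n)} {i : Fin (n + 1)} :
    insertMax p i ∈ avoiders (n + 1) pattern123 ↔
      p ∈ avoiders n pattern123 ∧ i ∈ activeSites p := by
  simp only [mem_avoiders_pattern123, mem_activeSites_iff_strictAntiOn]
  refine ⟨fun h => ⟨fun a b c hab hbc hpab hpbc => ?_, fun a _ b hb hab => ?_⟩, ?_⟩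
  · exact h (i.succAbove a) (i.succAbove b) (i.succAbove c) (by simpa) (by simpa)
      (by simpa [insertMax_apply_succAbove_lt_succAbove])
      (by simpa [insertMax_apply_succAbove_lt_succAbove])
  · refine lt_of_le_of_ne (not_lt.1 fun hlt => ?_) (p.injective.ne hab.ne')
    exact h (i.succAbove a) (i.succAbove b) i (by simpa)
      ((Fin.succAbove_lt_iff_castSucc_lt _ _).2 hb)
      (by simpa [insertMax_apply_succAbove_lt_succAbove]) (insertMax_apply_succAbove_lt_self p i b)
  · rintro ⟨h, hdec⟩ a b c hab hbc hpab hpbc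
    obtain rfl | ⟨a, rfl⟩ := Fin.eq_self_or_eq_succAbove i a
    · exact not_insertMax_apply_self_lt p _ _ hpab
    obtain rfl | ⟨b, rfl⟩ := Fin.eq_self_or_eq_succAbove i b
    · exact not_insertMax_apply_self_lt p _ _ hpbc
    rw [Fin.succAbove_lt_succAbove_iff] at hab
    rw [insertMax_apply_succAbove_lt_succAbove] at hpab
    obtain rfl | ⟨c, rfl⟩ := Fin.eq_self_or_eq_succAbove i c
    · have hb := (Fin.succAbove_lt_iff_castSucc_lt _ _).1 hbc
      exact (hdec ((Fin.castSucc_lt_castSucc_iff.2 hab).trans hb) hb hab).not_gt hpab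
    · rw [Fin.succAbove_lt_succAbove_iff] at hbc
      rw [insertMax_apply_succAbove_lt_succAbove] at hpbc
      exact h a b c hab hbc hpab hpbc

theorem sum_avoiders_succ {M : Type*} [AddCommMonoid M] (h : Equiv.Perm (Fin (n + 1)) → M) :
    ∑ σ ∈ avoiders (n + 1) pattern123, h σ =
      ∑ p ∈ avoiders n pattern123, ∑ i ∈ activeSites p, h (insertMax p i) :=
  calc
    _ = ∑ x : Equiv.Perm (Fin n) × Fin (n + 1) with
          insertMax x.1 x.2 ∈ avoiders (n + 1) pattern123, h (insertMax x.1 x.2) :=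
      (Finset.sum_bijective _ (insertMax_bijective n) (by simp) fun _ _ => rfl).symm
    _ = _ :=
      Finset.sum_finset_product' _ (avoiders n pattern123) activeSites
        (by simp [insertMax_mem_avoiders_iff]) (f := fun p i => h (insertMax p i))

theorem card_avoiders_eq_sum_ballot (r m n : ℕ) (h : m + r = n) :
    ((avoiders n pattern123).card : ℚ) =
      ∑ p ∈ avoiders m pattern123, ballot r (initialRun p) := by
  induction r generalizing m with
  | zero => subst h; simp [ballot_zero_left]
  | succ r ih =>
    rw [ih (m + 1) (by omega), sum_avoiders_succ]
    refine Finset.sum_congr rfl fun p _ => ?_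
    rw [sum_activeSites p (ballot r), sum_Icc_ballot]

theorem sum_avoiders_le_sum_ballot (F : ∀ {m : ℕ}, Equiv.Perm (Fin m) → ℚ)
    (hF : ∀ {m : ℕ} (p : Equiv.Perm (Fin m)), ∀ i ∈ activeSites p,
      F (insertMax p i) ≤ F p + (initialRun (insertMax p i) : ℚ) ^ 2)
    (r m n : ℕ) (h : m + r = n) :
    ∑ p ∈ avoiders n pattern123, F p ≤ ∑ p ∈ avoiders m pattern123,
      ballot r (initialRun p) * (F p + labelSqBound r (initialRun p)) := by
  induction r generalizing m with
  | zero => subst h; simp [ballot_zero_left, labelSqBound_zero_left]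
  | succ r ih =>
    refine (ih (m + 1) (by omega)).trans ?_
    rw [sum_avoiders_succ]
    refine Finset.sum_le_sum fun p _ => ?_
    let u : ℕ → ℚ := fun t => ballot r t * (F p + (t ^ 2 + labelSqBound r t))
    calc
      _ ≤ ∑ i ∈ activeSites p, u (initialRun (insertMax p i)) := by
        refine Finset.sum_le_sum fun i hi => mul_le_mul_of_nonneg_left ?_ (ballot_nonneg _ _)
        linarith [hF p i hi]
      _ = ballot (r + 1) (initialRun p) * F p + ∑ t ∈ Finset.Icc 1 (initialRun p + 1),
            ballot r t * ((t : ℚ) ^ 2 + labelSqBound r t) := by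
        rw [sum_activeSites p u, ← sum_Icc_ballot, Finset.sum_mul, ← Finset.sum_add_distrib]
        simp only [u, mul_add]
      _ ≤ _ := by
        rw [mul_add]
        exact add_le_add_right (sum_Icc_ballot_mul_le r _) _

end GeneratingTree

section Noninversions

variable {α β : Type*} [Fintype α] [LinearOrder α] [LinearOrder β]

/-- The noninversions of `p`: the pairs of positions, in increasing order, at which the entries of
`p` increase. -/
def noninversions (p : α → β) : Finset (α × α) :=
  {x | x.1 < x.2 ∧ p x.1 < p x.2}

theorem card_noninversions_insertMax {n : ℕ} (p : Equiv.Perm (Fin n)) (i : Fin (n + 1)) :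
    (noninversions (insertMax p i)).card = (noninversions p).card + i := by
  have card_before : ∑ x : Fin n, (if x.castSucc < i then 1 else 0) = (i : ℕ) := by
    rw [← Finset.card_filter]
    exact Fin.card_filter_val_lt.trans (min_eq_right (Nat.lt_succ_iff.1 i.2))
  simp only [noninversions, Finset.card_filter, Fintype.sum_prod_type,
    Fin.sum_univ_succAbove _ i, insertMax_apply_succAbove_lt_succAbove,
    insertMax_apply_succAbove_lt_self, not_insertMax_apply_self_lt,
    Fin.succAbove_lt_succAbove_iff, Fin.succAbove_lt_iff_castSucc_lt, and_true, and_false,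
    if_false, Finset.sum_const_zero, Finset.sum_add_distrib, card_before]
  omega

theorem card_noninversions_insertMax_le {n : ℕ} {p : Equiv.Perm (Fin n)} {i : Fin (n + 1)}
    (hi : i ∈ activeSites p) : (noninversions (insertMax p i)).card ≤
      (noninversions p).card + initialRun (insertMax p i) := by
  rw [card_noninversions_insertMax, initialRun_insertMax hi]
  split_ifs <;> omega

theorem sq_card_noninversions_insertMax_div_le {n : ℕ} {p : Equiv.Perm (Fin n)} {i : Fin (n + 1)}
    (hi : i ∈ activeSites p) :
    ((noninversions (insertMax p i)).card : ℚ) ^ 2 / ((n + 1 : ℕ) + 1) ≤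
      (noninversions p).card ^ 2 / (n + 1) + initialRun (insertMax p i) ^ 2 := by
  have card_le : ((noninversions (insertMax p i)).card : ℚ) ≤
      (noninversions p).card + initialRun (insertMax p i) := by
    exact_mod_cast card_noninversions_insertMax_le hi
  have cauchy_schwarz := Finset.sq_sum_div_le_sum_sq_div Finset.univ
    ![((noninversions p).card : ℚ), initialRun (insertMax p i)] (g := ![(n + 1 : ℚ), 1])
    (by simpa [Fin.forall_fin_two] using n.cast_add_one_pos)
  simp only [Fin.sum_univ_two, Matrix.cons_val_zero, Matrix.cons_val_one, div_one] at cauchy_schwarz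
  push_cast
  refine le_trans ?_ cauchy_schwarz
  gcongr

theorem sum_sq_card_noninversions_le (n : ℕ) :
    ∑ p ∈ avoiders n pattern123, ((noninversions p).card : ℚ) ^ 2 ≤
      (avoiders n pattern123).card * (3 * n ^ 2 * (n + 1)) := by
  let F : ∀ {m : ℕ}, Equiv.Perm (Fin m) → ℚ := fun {m} p => (noninversions p).card ^ 2 / (m + 1)
  have sum_F_le : ∑ p ∈ avoiders n pattern123, F p ≤
      (avoiders n pattern123).card * (3 * n ^ 2) := by
    refine (sum_avoiders_le_sum_ballot F
      (fun _ _ hi => sq_card_noninversions_insertMax_div_le hi) n 0 n (zero_add n)).trans_eq ?_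
    rw [card_avoiders_eq_sum_ballot n 0 n (zero_add n), Finset.sum_mul]
    refine Finset.sum_congr rfl fun p _ => ?_
    have run_eq_zero : initialRun p = 0 := Nat.le_zero.1 (initialRun_le p)
    have noninversions_eq_empty : noninversions p = ∅ := Finset.eq_empty_of_isEmpty _
    simp only [F, run_eq_zero, noninversions_eq_empty, labelSqBound, Finset.card_empty]
    push_cast
    ring
  rw [← Finset.sum_div, div_le_iff₀ (by positivity)] at sum_F_le
  linarith

theorem eventually_mul_sum_card_noninversions_lt (D : ℕ) : ∀ᶠ n in Filter.atTop,
    D * ∑ p ∈ avoiders n pattern123, (noninversions p).card <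
      (avoiders n pattern123).card * n.choose 2 := by
  filter_upwards [Filter.eventually_ge_atTop (12 * D ^ 2 + 5)] with n hn
  have hn' : (12 * D ^ 2 + 5 : ℚ) ≤ n := by exact_mod_cast hn
  have card_pos : (0 : ℚ) < (avoiders n pattern123).card :=
    Nat.cast_pos.2 (Finset.card_pos.2 ⟨_, decreasingPerm_mem_avoiders n⟩)
  have cauchy_schwarz := sq_sum_le_card_mul_sum_sq (s := avoiders n pattern123)
    (f := fun p => ((noninversions p).card : ℚ))
  have second_moment := sum_sq_card_noninversions_le n
  rw [← Nat.cast_lt (α := ℚ)]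
  push_cast [Nat.cast_choose_two]
  set A : ℚ := ((avoiders n pattern123).card : ℚ)
  set S : ℚ := ∑ p ∈ avoiders n pattern123, ((noninversions p).card : ℚ)
  have sq_sum_le : S ^ 2 ≤ A ^ 2 * (3 * n ^ 2 * (n + 1)) := by nlinarith
  refine lt_of_pow_lt_pow_left₀ 2 ?_ ?_
  · have sub_nonneg : (0 : ℚ) ≤ n - 1 := by nlinarith
    positivity
  calc
    (D * S) ^ 2 = D ^ 2 * S ^ 2 := mul_pow _ _ _
    _ ≤ D ^ 2 * (A ^ 2 * (3 * n ^ 2 * (n + 1))) := by gcongr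
    _ = (A * n / 2) ^ 2 * (12 * D ^ 2 * (n + 1)) := by ring
    _ < (A * n / 2) ^ 2 * (n - 1) ^ 2 := by
      have n_pos : (0 : ℚ) < n := by nlinarith
      gcongr
      nlinarith
    _ = (A * (n * (n - 1) / 2)) ^ 2 := by ring

end Noninversions

section Selections

variable {α β : Type*} [Fintype α] [LinearOrder α] [LinearOrder β]

open Classical in
theorem card_strictMono_superset {k : ℕ} {t : Finset α} (ht : t.card ≤ k) :
    Finset.card {f : Fin k → α | StrictMono f ∧ ↑t ⊆ Set.range f} =
      (Fintype.card α - t.card).choose (k - t.card) := by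
  rw [← Finset.card_univ, ← Finset.card_filter_powersetCard_subset t _ k (Finset.subset_univ t) ht]
  refine Finset.card_nbij (fun f => Finset.univ.image f) ?_ ?_ ?_
  · intro f hf
    obtain ⟨hf, ht⟩ := (Finset.mem_filter_univ _).1 hf
    have subset_image : t ⊆ Finset.univ.image f := Finset.coe_subset.1 (by simpa using ht)
    simp [Finset.card_image_of_injective _ hf.injective, subset_image]
  · intro f hf g hg hfg
    have hf := ((Finset.mem_filter_univ _).1 hf).1
    have hg := ((Finset.mem_filter_univ _).1 hg).1
    refine (hf.range_inj hg).1 ?_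
    simpa using Finset.coe_inj.2 hfg
  · intro s hs
    obtain ⟨hs, hts⟩ := Finset.mem_filter.1 hs
    have hs := (Finset.mem_powersetCard.1 hs).2
    exact ⟨s.orderEmbOfFin hs, by simp [hts, (s.orderEmbOfFin hs).strictMono], by simp⟩

open Classical in
/-- The increasing selections of `k` positions at which the entries of `p` are not decreasing. -/
noncomputable def nonAntitoneSelections (k : ℕ) (p : α → β) : Finset (Fin k → α) :=
  {f | StrictMono f ∧ ¬ Antitone (p ∘ f)}

theorem card_nonAntitoneSelections_le {k : ℕ} (hk : 2 ≤ k) (p : α → β) :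
    (nonAntitoneSelections k p).card ≤
      (noninversions p).card * (Fintype.card α - 2).choose (k - 2) := by
  classical
  have covered : nonAntitoneSelections k p ⊆ (noninversions p).biUnion fun x =>
      {f : Fin k → α | StrictMono f ∧ ↑({x.1, x.2} : Finset α) ⊆ Set.range f} := by
    intro f hf
    obtain ⟨hf, hp⟩ := (Finset.mem_filter_univ _).1 hf
    simp only [antitone_iff_forall_lt, Function.comp_apply, not_forall, not_le] at hp
    obtain ⟨a, b, hab, hlt⟩ := hp
    rw [Finset.mem_biUnion]
    exact ⟨(f a, f b), by simp [noninversions, hf hab, hlt], by simp [hf, Set.pair_subset_iff]⟩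
  refine (Finset.card_le_card covered).trans (Finset.card_biUnion_le_card_mul _ _ _ ?_)
  intro x hx
  have card_pair : ({x.1, x.2} : Finset α).card = 2 :=
    Finset.card_pair ((Finset.mem_filter_univ _).1 hx).1.ne
  rw [card_strictMono_superset (card_pair.trans_le hk), card_pair]

theorem choose_two_mul_card_nonAntitoneSelections_le (k : ℕ) (p : α → β) :
    (Fintype.card α).choose 2 * (nonAntitoneSelections k p).card ≤
      k.choose 2 * (Fintype.card α).choose k * (noninversions p).card := by
  obtain hk | hk := lt_or_ge k 2
  · have : Subsingleton (Fin k) := Fin.subsingleton_iff_le_one.2 (by omega)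
    simp [nonAntitoneSelections, Subsingleton.antitone]
  · calc
      _ ≤ (Fintype.card α).choose 2 *
          ((noninversions p).card * (Fintype.card α - 2).choose (k - 2)) := by
        gcongr
        exact card_nonAntitoneSelections_le hk p
      _ = (Fintype.card α).choose k * k.choose 2 * (noninversions p).card := by
        rw [Nat.choose_mul hk]
        ring
      _ = _ := by ring

end Selections

section Patterns

variable {k n : ℕ} {q : Equiv.Perm (Fin k)} {p : Equiv.Perm (Fin n)} {f : Fin k → Fin n}

theorem antitone_iff_eq_decreasingPerm : Antitone q ↔ q = decreasingPerm k := by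
  refine ⟨fun h => ?_, ?_⟩
  · have rev_mono : StrictMono (Fin.rev ∘ q) :=
      Fin.rev_strictAnti.comp (h.strictAnti_of_injective q.injective)
    have rev_eq_id : Fin.rev ∘ q = id := (rev_mono.range_inj strictMono_id).1 <| by
      simp [(Fin.rev_surjective.comp q.surjective).range_eq]
    exact Equiv.ext fun a => Fin.rev_eq_iff.1 (congrFun rev_eq_id a)
  · rintro rfl
    exact Fin.rev_anti

theorem IsOccurrence.antitone_comp_iff (h : IsOccurrence q p f) :
    Antitone (p ∘ f) ↔ Antitone q := by
  simp only [antitone_iff_forall_lt, Function.comp_apply, ← not_lt, h.2]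

theorem isOccurrence_decreasingPerm_iff :
    IsOccurrence (decreasingPerm k) p f ↔ StrictMono f ∧ Antitone (p ∘ f) := by
  refine ⟨fun h => ⟨fun a b => h.1 a b, ?_⟩, fun ⟨hf, hp⟩ => ⟨fun a b => @hf a b, fun a b => ?_⟩⟩
  · exact h.antitone_comp_iff.2 (antitone_iff_eq_decreasingPerm.2 rfl)
  · have hanti := hp.strictAnti_of_injective (p.injective.comp hf.injective)
    exact Fin.rev_lt_rev.trans hanti.lt_iff_gt.symm

theorem patternCount_decreasingPerm_add_card (k : ℕ) (p : Equiv.Perm (Fin n)) :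
    patternCount (decreasingPerm k) p + (nonAntitoneSelections k p).card = n.choose k := by
  classical
  have card_selections := card_strictMono_superset (α := Fin n) (t := ∅) (Nat.zero_le k)
  rw [patternCount, nonAntitoneSelections]
  simp only [isOccurrence_decreasingPerm_iff]
  rw [← Finset.filter_filter, ← Finset.filter_filter, Finset.card_filter_add_card_filter_not]
  simpa using card_selections

theorem patternCount_le_card_nonAntitoneSelections (hq : q ≠ decreasingPerm k)
    (p : Equiv.Perm (Fin n)) : patternCount q p ≤ (nonAntitoneSelections k p).card := by
  classical
  refine Finset.card_le_card (Finset.monotone_filter_right _ fun f _ h => ⟨fun a b => h.1 a b, ?_⟩)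
  rwa [h.antitone_comp_iff, antitone_iff_eq_decreasingPerm]

end Patterns

theorem mainTheorem9 (k : ℕ) (hk : 0 < k) (q : Equiv.Perm (Fin k))
    (hq : q ≠ decreasingPerm k) :
    ∃ N : ℕ, ∀ n : ℕ, N ≤ n →
      totalCount (decreasingPerm k) (avoiders n pattern123) >
        totalCount q (avoiders n pattern123) := by
  obtain ⟨N, hN⟩ := Filter.eventually_atTop.1
    (eventually_mul_sum_card_noninversions_lt (2 * k.choose 2))
  refine ⟨max N k, fun n hn => ?_⟩
  set C := avoiders n pattern123
  set S := ∑ p ∈ C, (nonAntitoneSelections k p).card with hS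
  have count_le : totalCount q C ≤ S :=
    Finset.sum_le_sum fun p _ => patternCount_le_card_nonAntitoneSelections hq p
  have count_add : totalCount (decreasingPerm k) C + S = C.card * n.choose k := by
    simp only [totalCount, hS, ← Finset.sum_add_distrib, patternCount_decreasingPerm_add_card,
      Finset.sum_const, smul_eq_mul]
  have S_le : n.choose 2 * S ≤ k.choose 2 * n.choose k * ∑ p ∈ C, (noninversions p).card := by
    rw [hS, Finset.mul_sum, Finset.mul_sum]
    exact Finset.sum_le_sum fun p _ => by
      simpa using choose_two_mul_card_nonAntitoneSelections_le k p
  have two_mul_S_lt : n.choose 2 * (2 * S) < n.choose 2 * (C.card * n.choose k) := by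
    have noninversions_lt := Nat.mul_lt_mul_of_pos_right (hN n (le_of_max_le_left hn))
      (Nat.choose_pos (le_of_max_le_right hn))
    linarith
  linarith [Nat.lt_of_mul_lt_mul_left two_mul_S_lt]
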